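/- A vertex operator algebra is a vertex algebra $(V,Y,\mathbf 1)$ over $\mathbb{C}$ together with a conformal vector $\omega$ and a grading $V=\coprod_{k\in\mathbb{Z}}V_k$ into finite-dimensional weight spaces, with $V_k=0$ for $k$ sufficiently negative, $\mathbf 1\in V_0$ and $\omega\in V_2$, such that the operators $L(m)=\omega_{m+1}$ satisfy the Virasoro relations for some central charge, $L(0)$ acts on $V_k$ as $k$, and $Y(L(-1)v,x)=\frac{d}{dx}Y(v,x)$. Here $Y(u,x)=\sum_{j\in\mathbb{Z}}u_jx^{-j-1}$, and $\mathrm{wt}\,u=k$ for a nonzero $u\in V_k$. For $n\in\mathbb{N}$ put $$O^L(V)=\{(L(-1)+L(0))v \mid v\in V\},$$ $$O_n^\circ(V)=\mathrm{span}\{u\circ_n v \mid u\in V \text{ homogeneous},\ v\in V\},\qquad u\circ_n v=\mathrm{Res}_x\frac{(1+x)^{\mathrm{wt}\,u+n}\,Y(u,x)v}{x^{2n+2}},$$ and $O_n(V)=O^L(V)+O_n^\circ(V)$, so that the level $n$ Zhu algebra is $A_n(V)=V/O_n(V)$. The algebra $V$ is strongly generated by $u\in V$ if it is spanned by the vectors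 $u_{-k_1}\cdots u_{-k_r}\mathbf 1$ with $r\ge 0$ and $k_1,\dots,k_r\ge 1$. **Theorem.** Let $V$ be a vertex operator algebra that is strongly generated by a nonzero homogeneous vector $u\in V$, and let $n\ge 1$ be an integer. Suppose that one of the following holds: (i) $1\le \mathrm{wt}\,u\le n$; or (ii) $\mathrm{wt}\,u=0$ and $u_{-2}\mathbf 1\ne 0$. Then $(L(-1)+L(0))u\notin O_n^\circ(V)$. Hence $O^L(V)\not\subset O_n^\circ(V)$, and $O_n^\circ(V)$ is a proper subspace of $O_n(V)$. -/

import Mathlib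

/-- A vertex algebra structure over `ℂ` on `V`. The vertex operator `Y(u, x)` is a Mathlib
`VertexOperator`, i.e. a linear map from `V` to Laurent series with coefficients in `V`; this is
the truncation condition `u_n v = 0` for `n` large. The mode `u_n`, the coefficient of `x^(-n-1)`
in `Y(u, x)`, is `VertexOperator.ncoeff (Y u) n`. -/
structure VertexAlgebra (V : Type*) [AddCommGroup V] [Module ℂ V] where
  /-- the state-field correspondence -/
  Y : V →ₗ[ℂ] VertexOperator ℂ V
  /-- the vacuum vector -/
  vac : V
  /-- `Y(1, x)` is the identity -/
  vacuum : ∀ (n : ℤ) (v : V),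
    VertexOperator.ncoeff (Y vac) n v = if n = -1 then v else 0
  /-- `Y(v, x) 1` has no negative powers of `x` ... -/
  creation_regular : ∀ (v : V) (n : ℤ), 0 ≤ n → VertexOperator.ncoeff (Y v) n vac = 0
  /-- ... and its constant term is `v` -/
  creation : ∀ v : V, VertexOperator.ncoeff (Y v) (-1) vac = v
  /-- the Jacobi identity, written in modes (Borcherds identity); all sums are finite because of
  truncation -/
  jacobi : ∀ (u v w : V) (l m n : ℤ),
    ∑ᶠ i : ℕ, ((Ring.choose m i : ℤ) : ℂ) •
        VertexOperator.ncoeff (Y (VertexOperator.ncoeff (Y u) (l + i) v)) (m + n - i) w =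
      (∑ᶠ i : ℕ, ((-1 : ℂ) ^ i * ((Ring.choose l i : ℤ) : ℂ)) •
        VertexOperator.ncoeff (Y u) (m + l - i) (VertexOperator.ncoeff (Y v) (n + i) w)) -
      (∑ᶠ i : ℕ, ((-1 : ℂ) ^ l * (-1 : ℂ) ^ i * ((Ring.choose l i : ℤ) : ℂ)) •
        VertexOperator.ncoeff (Y v) (n + l - i) (VertexOperator.ncoeff (Y u) (m + i) w))

namespace VertexAlgebra

/-- The mode `u_n : V → V`. -/
noncomputable def mode {V : Type*} [AddCommGroup V] [Module ℂ V] (A : VertexAlgebra V)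
    (u : V) (n : ℤ) : Module.End ℂ V :=
  VertexOperator.ncoeff (A.Y u) n

/-- `word [(u₁, k₁), …, (u_r, k_r)]` is the vector `(u₁)_{k₁} ⋯ (u_r)_{k_r} 1`. -/
noncomputable def word {V : Type*} [AddCommGroup V] [Module ℂ V] (A : VertexAlgebra V)
    (l : List (V × ℤ)) : V :=
  l.foldr (fun p v => A.mode p.1 p.2 v) A.vac

/-- `V` is positively generated at `K` by `S`: it is spanned by the vectors
`(u₁)_{k₁} ⋯ (u_r)_{k_r} 1` with `r ≥ 0`, all `u_i ∈ S` and all `k_i ≤ -K`. -/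
def PositivelyGenerated {V : Type*} [AddCommGroup V] [Module ℂ V] (A : VertexAlgebra V)
    (K : ℤ) (S : Set V) : Prop :=
  Submodule.span ℂ
    {x : V | ∃ l : List (V × ℤ), (∀ p ∈ l, p.1 ∈ S ∧ p.2 ≤ -K) ∧ x = A.word l} = ⊤

/-- `V` is strongly generated by `S`: the set `S` is finite and `V` is positively generated at
`1` by `S`. -/
def StronglyGenerated {V : Type*} [AddCommGroup V] [Module ℂ V] (A : VertexAlgebra V)
    (S : Set V) : Prop :=
  S.Finite ∧ A.PositivelyGenerated 1 S

end VertexAlgebra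

/-- A vertex operator algebra structure over `ℂ` on `V`, with weight spaces `wt k`. -/
structure VertexOperatorAlgebra (V : Type*) [AddCommGroup V] [Module ℂ V]
    extends VertexAlgebra V where
  /-- the space of vectors of weight `k` -/
  wt : ℤ → Submodule ℂ V
  /-- `V` is the direct sum of its weight spaces -/
  isInternal : DirectSum.IsInternal wt
  finiteDimensional : ∀ k, FiniteDimensional ℂ (wt k)
  /-- `V_k = 0` for `k` sufficiently negative -/
  bddBelow : ∃ N : ℤ, ∀ k < N, wt k = ⊥
  vac_mem : vac ∈ wt 0
  /-- the conformal vector -/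
  conf : V
  conf_mem : conf ∈ wt 2
  /-- the central charge -/
  c : ℂ
  /-- `L(m) = ω_{m+1}` satisfy the Virasoro relations -/
  virasoro : ∀ (m n : ℤ) (v : V),
    toVertexAlgebra.mode conf (m + 1) (toVertexAlgebra.mode conf (n + 1) v) -
        toVertexAlgebra.mode conf (n + 1) (toVertexAlgebra.mode conf (m + 1) v) =
      ((m : ℂ) - n) • toVertexAlgebra.mode conf (m + n + 1) v +
        (if m + n = 0 then ((m : ℂ) ^ 3 - m) / 12 * c else 0) • v
  /-- `L(0) = ω_1` acts on `V_k` as `k` -/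
  L_zero : ∀ (k : ℤ), ∀ v ∈ wt k, toVertexAlgebra.mode conf 1 v = (k : ℂ) • v
  /-- the `L(-1)`-derivative property `Y(L(-1)v, x) = d/dx Y(v, x)`, in modes -/
  L_neg_one : ∀ (v w : V) (n : ℤ),
    toVertexAlgebra.mode (toVertexAlgebra.mode conf 0 v) n w =
      -(n : ℂ) • toVertexAlgebra.mode v (n - 1) w

namespace VertexOperatorAlgebra

/-- The Virasoro operator `L(m) = ω_{m+1}`. -/
noncomputable def L {V : Type*} [AddCommGroup V] [Module ℂ V] (A : VertexOperatorAlgebra V)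
    (m : ℤ) : Module.End ℂ V :=
  A.mode A.conf (m + 1)

/-- The circle product `u ∘_n v = Res_x (1 + x)^(k + n) x^(-2n-2) Y(u, x) v`, for `u` of weight
`k`. Here `(1 + x)^(k + n)` is expanded in nonnegative powers of `x`, and
`Res_x x^j Y(u, x) v = u_j v`; the sum is finite because of truncation. -/
noncomputable def circ {V : Type*} [AddCommGroup V] [Module ℂ V] (A : VertexOperatorAlgebra V)
    (n : ℕ) (k : ℤ) (u v : V) : V :=
  ∑ᶠ i : ℕ, ((Ring.choose (k + n) i : ℤ) : ℂ) • A.mode u (i - 2 * n - 2) v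

/-- `O_n°(V)`: the span of all `u ∘_n v` with `u` homogeneous. -/
noncomputable def Ocirc {V : Type*} [AddCommGroup V] [Module ℂ V] (A : VertexOperatorAlgebra V)
    (n : ℕ) : Submodule ℂ V :=
  Submodule.span ℂ {x : V | ∃ k : ℤ, ∃ u ∈ A.wt k, ∃ v : V, x = A.circ n k u v}

/-- `O^L(V) = {(L(-1) + L(0)) v | v ∈ V}`. -/
noncomputable def OL {V : Type*} [AddCommGroup V] [Module ℂ V] (A : VertexOperatorAlgebra V) :
    Submodule ℂ V :=
  LinearMap.range (A.L (-1) + A.L 0)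

/-- `O_n(V) = O^L(V) + O_n°(V)`; the level `n` Zhu algebra is `V / O_n(V)`. -/
noncomputable def zhuO {V : Type*} [AddCommGroup V] [Module ℂ V] (A : VertexOperatorAlgebra V)
    (n : ℕ) : Submodule ℂ V :=
  A.OL ⊔ A.Ocirc n

end VertexOperatorAlgebra

/-!
The proof compares weights. Commuting `L(0)` past a mode shows that `u_j` maps `V_m` to
`V_{wt u + m - j - 1}` (`VertexOperatorAlgebra.mode_mem_wt`), so the modes `u_{-1}, u_{-2}, …` of a
generator of nonnegative weight never lower the weight, and strong generation forces `V` to have no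
negative weights (`VertexOperatorAlgebra.wtGE_zero_eq_top`). In
`a ∘_n v = ∑ i, (wt a + n choose i) a_{i - 2n - 2} v` with `a` homogeneous of weight at least `0`,
only the terms with `i ≤ wt a + n` survive, and these have weight at least `n + 1`. Hence
`O_n°(V)` lies in the sum of the weight spaces of weight at least `n + 1`
(`VertexOperatorAlgebra.Ocirc_le_wtGE`).

On the other hand, `(L(-1) + L(0)) u` has the component `(wt u) u` in weight `wt u` and the
component `L(-1) u = u_{-2} 1` in weight `wt u + 1`. The first is nonzero of weight at most `n` in
case (i), and the second is nonzero of weight `1 ≤ n` in case (ii).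
-/

namespace VertexOperatorAlgebra

variable {V : Type*} [AddCommGroup V] [Module ℂ V] (A : VertexOperatorAlgebra V)

/-- The sum of the weight spaces of weight at least `N`. -/
def wtGE (N : ℤ) : Submodule ℂ V :=
  ⨆ j : {j : ℤ // N ≤ j}, A.wt j

lemma wt_le_wtGE {N k : ℤ} (h : N ≤ k) : A.wt k ≤ A.wtGE N :=
  le_iSup (fun j : {j : ℤ // N ≤ j} => A.wt j) ⟨k, h⟩

lemma wtGE_anti : Antitone A.wtGE := fun _ _ h =>
  iSup_le fun j => A.wt_le_wtGE (h.trans j.2)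

lemma disjoint_wt_wtGE {k N : ℤ} (h : k < N) : Disjoint (A.wt k) (A.wtGE N) := by
  refine (A.isInternal.submodule_iSupIndep k).mono_right (iSup_le fun j => ?_)
  exact le_iSup₂_of_le (j : ℤ) (ne_of_gt (h.trans_le j.2)) le_rfl

/-- The weight spaces are the full eigenspaces of `L(0) = ω_1`: the axiom `L_zero` gives one
inclusion, and the other holds because `V` is the sum of the weight spaces. -/
lemma wt_eq_eigenspace (k : ℤ) :
    A.wt k = Module.End.eigenspace (A.mode A.conf 1) (k : ℂ) := by
  have hle : ∀ j : ℤ, A.wt j ≤ Module.End.eigenspace (A.mode A.conf 1) (j : ℂ) := fun j v hv =>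
    Module.End.mem_eigenspace_iff.2 (A.L_zero j v hv)
  refine le_antisymm (hle k) ?_
  have hind := (Module.End.eigenspaces_iSupIndep (A.mode A.conf 1)).comp
    (f := fun j : ℤ => (j : ℂ)) Int.cast_injective
  intro v hv
  have hv' : v ∈ A.wt k ⊔ ⨆ j ≠ k, A.wt j := by
    have : (⨆ j, A.wt j) ≤ A.wt k ⊔ ⨆ j ≠ k, A.wt j := by
      refine iSup_le fun j => ?_
      by_cases h : j = k
      · exact h ▸ le_sup_left
      · exact le_sup_of_le_right (le_iSup₂_of_le j h le_rfl)
    exact this (A.isInternal.submodule_iSup_eq_top ▸ Submodule.mem_top)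
  obtain ⟨x, hx, y, hy, rfl⟩ := Submodule.mem_sup.1 hv'
  have hyk : y ∈ Module.End.eigenspace (A.mode A.conf 1) (k : ℂ) := by
    simpa using Submodule.sub_mem _ hv (hle k hx)
  have hy0 : y = 0 := Submodule.disjoint_def.1 (hind k) y hyk
    (iSup₂_mono (fun j _ => hle j) hy)
  simpa [hy0] using hx

/-- The commutator formula `[L(0), u_j] = (L(-1) u)_{j+1} + (L(0) u)_j`, which is the Borcherds
identity for `ω` and `u` with `l = 0` and `m = 1`. -/
lemma mode_conf_one_mode (u w : V) (j : ℤ) :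
    A.mode (A.mode A.conf 0 u) (j + 1) w + A.mode (A.mode A.conf 1 u) j w =
      A.mode A.conf 1 (A.mode u j w) - A.mode u j (A.mode A.conf 1 w) := by
  have h := A.jacobi A.conf u w 0 1 j
  rw [finsum_eq_sum_of_support_subset (s := Finset.range 2),
    finsum_eq_sum_of_support_subset (s := Finset.range 1),
    finsum_eq_sum_of_support_subset (s := Finset.range 1)] at h
  · simpa [Finset.sum_range_succ, add_comm, VertexAlgebra.mode] using h
  · intro i hi
    by_contra hi'
    obtain ⟨i, rfl⟩ : ∃ i', i = i' + 1 := ⟨i - 1, by simp at hi'; omega⟩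
    simp [Ring.choose_zero_succ] at hi
  · intro i hi
    by_contra hi'
    obtain ⟨i, rfl⟩ : ∃ i', i = i' + 1 := ⟨i - 1, by simp at hi'; omega⟩
    simp [Ring.choose_zero_succ] at hi
  · intro i hi
    by_contra hi'
    have h2 : 1 < i := by simp at hi'; omega
    have : Ring.choose (1 : ℤ) i = 0 := by
      have := Ring.choose_natCast (R := ℤ) 1 i
      rw [Nat.choose_eq_zero_of_lt h2] at this
      simpa using this
    simp [this] at hi

lemma mode_mem_wt {u w : V} {k m : ℤ} (hu : u ∈ A.wt k) (hw : w ∈ A.wt m) (j : ℤ) :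
    A.mode u j w ∈ A.wt (k + m - j - 1) := by
  rw [wt_eq_eigenspace, Module.End.mem_eigenspace_iff]
  have h := A.mode_conf_one_mode u w j
  have hk : A.mode (A.mode A.conf 1 u) j w = (k : ℂ) • A.mode u j w := by
    rw [A.L_zero k u hu]; simp [VertexAlgebra.mode]
  rw [A.L_neg_one, hk, A.L_zero m w hw, map_smul, add_sub_cancel_right, eq_sub_iff_add_eq] at h
  rw [← h]
  push_cast
  module

lemma mode_mem_wtGE {u w : V} {k N : ℤ} (hu : u ∈ A.wt k) (hw : w ∈ A.wtGE N) (j : ℤ) :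
    A.mode u j w ∈ A.wtGE (k + N - j - 1) := by
  suffices h : A.wtGE N ≤ (A.wtGE (k + N - j - 1)).comap (A.mode u j) from h hw
  exact iSup_le fun m x hx => A.wt_le_wtGE (by linarith [m.2]) (A.mode_mem_wt hu hx j)

/-- A vertex operator algebra strongly generated by homogeneous vectors of nonnegative weight has
no negative weights. -/
lemma wtGE_zero_eq_top {S : Set V} (hS : ∀ u ∈ S, ∃ k : ℤ, 0 ≤ k ∧ u ∈ A.wt k)
    (hgen : A.StronglyGenerated S) : A.wtGE 0 = ⊤ := by
  rw [eq_top_iff, ← hgen.2, Submodule.span_le]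
  rintro x ⟨l, hl, rfl⟩
  induction l with
  | nil => exact A.wt_le_wtGE le_rfl A.vac_mem
  | cons p l ih =>
    obtain ⟨hp, hl⟩ := List.forall_mem_cons.1 hl
    obtain ⟨k, hk, hu⟩ := hS p.1 hp.1
    exact A.wtGE_anti (by linarith [hp.2]) (A.mode_mem_wtGE hu (ih hl) p.2)

lemma circ_mem_wtGE (h : A.wtGE 0 = ⊤) (n : ℕ) {k : ℤ} {u : V} (hu : u ∈ A.wt k) (v : V) :
    A.circ n k u v ∈ A.wtGE (n + 1) := by
  refine finsum_induction (· ∈ A.wtGE (n + 1)) (zero_mem _) (fun _ _ => add_mem) fun i => ?_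
  rcases lt_or_ge k 0 with hk | hk
  · -- `(1 + x)^(k + n)` may be an infinite series here, but there are no vectors of weight `k < 0`.
    have hu0 : u = 0 := Submodule.disjoint_def.1 (A.disjoint_wt_wtGE hk) u hu (h ▸ Submodule.mem_top)
    simp [hu0, VertexAlgebra.mode]
  · lift k to ℕ using hk
    rcases lt_or_ge (k + n) i with hi | hi
    · have h0 : Ring.choose ((k : ℤ) + n) i = 0 := by
        rw [← Nat.cast_add, Ring.choose_natCast, Nat.choose_eq_zero_of_lt hi, Nat.cast_zero]
      simp [h0]
    · have hv : v ∈ A.wtGE 0 := h ▸ Submodule.mem_top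
      exact Submodule.smul_mem _ _ (A.wtGE_anti (by omega) (A.mode_mem_wtGE hu hv _))

lemma Ocirc_le_wtGE (h : A.wtGE 0 = ⊤) (n : ℕ) : A.Ocirc n ≤ A.wtGE (n + 1) := by
  rw [Ocirc, Submodule.span_le]
  rintro x ⟨k, u, hu, v, rfl⟩
  exact A.circ_mem_wtGE h n hu v

lemma L_neg_one_apply (u : V) : A.L (-1) u = A.mode u (-2) A.vac := by
  have h := A.L_neg_one u A.vac (-1)
  have h' : A.mode (A.mode A.conf 0 u) (-1) A.vac = A.mode A.conf 0 u := A.creation _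
  rw [h'] at h
  simpa [L] using h

lemma L_neg_one_mem_wt {u : V} {k : ℤ} (hu : u ∈ A.wt k) : A.L (-1) u ∈ A.wt (k + 1) := by
  have h := A.mode_mem_wt A.conf_mem hu 0
  rwa [show 2 + k - 0 - 1 = k + 1 by ring] at h

lemma L_zero_apply {u : V} {k : ℤ} (hu : u ∈ A.wt k) : A.L 0 u = (k : ℂ) • u :=
  A.L_zero k u hu

end VertexOperatorAlgebra

theorem mainTheorem2 {V : Type*} [AddCommGroup V] [Module ℂ V] (A : VertexOperatorAlgebra V)
    (n : ℕ) (hn : 1 ≤ n) (u : V) (hu : u ≠ 0) (hgen : A.StronglyGenerated {u})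
    (k : ℤ) (hk : u ∈ A.wt k)
    (hcase : (1 ≤ k ∧ k ≤ n) ∨ (k = 0 ∧ A.mode u (-2) A.vac ≠ 0)) :
    (A.L (-1) + A.L 0) u ∉ A.Ocirc n ∧
      ¬ A.OL ≤ A.Ocirc n ∧
      A.Ocirc n < A.zhuO n := by
  have hk0 : 0 ≤ k := by omega
  have htop : A.wtGE 0 = ⊤ := A.wtGE_zero_eq_top (by rintro _ rfl; exact ⟨k, hk0, hk⟩) hgen
  have hnot : (A.L (-1) + A.L 0) u ∉ A.Ocirc n := by
    intro hmem
    have h := A.Ocirc_le_wtGE htop n hmem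
    rw [LinearMap.add_apply, A.L_zero_apply hk] at h
    have hL := A.L_neg_one_mem_wt hk
    rcases hcase with ⟨hk1, hkn⟩ | ⟨rfl, hne⟩
    · -- Modulo weights at least `k + 1`, the vector is `k u`.
      have hku : (k : ℂ) • u ∈ A.wtGE (k + 1) :=
        (Submodule.add_mem_iff_right _ (A.wt_le_wtGE le_rfl hL)).1 (A.wtGE_anti (by omega) h)
      have := Submodule.disjoint_def.1 (A.disjoint_wt_wtGE (lt_add_one k)) _
        (Submodule.smul_mem _ _ hk) hku
      rcases smul_eq_zero.1 this with h0 | h0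
      · rw [Int.cast_eq_zero] at h0
        omega
      · exact hu h0
    · rw [Int.cast_zero, zero_smul, add_zero] at h
      have := Submodule.disjoint_def.1 (A.disjoint_wt_wtGE (by omega)) _ hL h
      exact hne (A.L_neg_one_apply u ▸ this)
  have hle : ¬ A.OL ≤ A.Ocirc n := fun hle => hnot (hle (LinearMap.mem_range_self _ u))
  exact ⟨hnot, hle, right_lt_sup.2 hle⟩
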